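/- Let $Q$ be a quiver with vertex set $Q_0$ (both $Q_0$ and the set of arrows are arbitrary sets; loops, oriented cycles and multiple arrows are allowed a priori). Define subsets $V_\alpha\subseteq Q_0$, for $\alpha$ an ordinal, by $V_0=\emptyset$; $V_{\beta+1}=\{i\in Q_0 \mid i \text{ is not the target of any arrow whose source lies outside } \bigcup_{\gamma\le\beta}V_\gamma\}$; and $V_\alpha=\bigcup_{\beta<\alpha}V_\beta$ if $\alpha$ is a limit ordinal. Assume that $Q$ is left rooted, i.e. $V_\lambda=Q_0$ for some ordinal $\lambda$. Let $\mathcal M$ be an abelian category that satisfies AB4 (it has small coproducts, and coproducts of monomorphisms are monomorphisms) and the dual axiom AB4$^*$, and that has enough projectives and enough injectives. Let $\mathrm{Rep}(Q,\mathcal M)$ be the abelian category of $\mathcal M$-valued representations of $Q$: an object $X$ consists of an object $X(i)\in\mathcal M$ for every vertex $i$ and a morphism $X(a)\colon X(i)\to X(j)$ for every arrow $a\colon i\to j$, and a morphism $X\to Y$ is a family of morphisms $X(i)\to Y(i)$, $i\in Q_0$, compatible with all the $X(a)$ and $Y(a)$. For $X\in\mathrm{Rep}(Q,\mathcal M)$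 and $i\in Q_0$ let $\varphi_i^X\colon\bigoplus_{a\colon j\to i}X(j)\to X(i)$ be the morphism whose component at an arrow $a\colon j\to i$ is $X(a)$; the coproduct is over all arrows with target $i$. For a class $\mathcal C$ of objects of an abelian category put $\mathcal C^\perp=\{N\mid \mathrm{Ext}^1(C,N)=0\ \forall C\in\mathcal C\}$ and ${}^\perp\mathcal C=\{N\mid \mathrm{Ext}^1(N,C)=0\ \forall C\in\mathcal C\}$. A pair $(\mathcal A,\mathcal B)$ of classes of objects is a cotorsion pair if $\mathcal A^\perp=\mathcal B$ and $\mathcal A={}^\perp\mathcal B$; it is hereditary if $\mathrm{Ext}^n(A,B)=0$ for all $A\in\mathcal A$, $B\in\mathcal B$, $n\ge1$; it is generated by a set if there is a set $\mathcal S$ of objects with $(\mathcal A,\mathcal B)=({}^\perp(\mathcal S^\perp),\mathcal S^\perp)$. Let $(\mathcal A,\mathcal B)$ be a cotorsion pair in $\mathcal M$, and set \[\Phi(\mathcal A)=\{X\in\mathrm{Rep}(Q,\mathcal M)\mid \varphi_i^X \text{ is a monomorphism and } X(i),\ \mathrm{Coker}\,\varphi_i^X\in\mathcal A \text{ for all }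 i\in Q_0\},\] \[\mathrm{Rep}(Q,\mathcal B)=\{Y\in\mathrm{Rep}(Q,\mathcal M)\mid Y(i)\in\mathcal B\text{ for all } i\in Q_0\}.\] Then $(\Phi(\mathcal A),\mathrm{Rep}(Q,\mathcal B))$ is a cotorsion pair in $\mathrm{Rep}(Q,\mathcal M)$. If $(\mathcal A,\mathcal B)$ is hereditary, then so is $(\Phi(\mathcal A),\mathrm{Rep}(Q,\mathcal B))$. If $(\mathcal A,\mathcal B)$ is generated by a set, then so is $(\Phi(\mathcal A),\mathrm{Rep}(Q,\mathcal B))$. -/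

import Mathlib

open CategoryTheory CategoryTheory.Limits

universe w v u

namespace QuiverCotorsion

/-! ### Ext-vanishing and cotorsion pairs in an abelian category -/

section Cotorsion

variable {C : Type u} [Category.{v} C] [Abelian C]

/-- `Ext^n_C(X, Y) = 0`. The groups `Ext` always exist in the universe `max u v`, so that no
smallness assumption is needed. -/
def ExtVanishes (X Y : C) (n : ℕ) : Prop :=
  letI := HasExt.standard C
  Subsingleton (Abelian.Ext.{max u v} X Y n)

/-- The class `𝒞^⊥` of all `N` with `Ext¹(X, N) = 0` for all `X` in `𝒞`. -/
def rightPerp (P : ObjectProperty C) : ObjectProperty C :=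
  fun N => ∀ X : C, P X → ExtVanishes X N 1

/-- The class `^⊥𝒞` of all `M` with `Ext¹(M, X) = 0` for all `X` in `𝒞`. -/
def leftPerp (P : ObjectProperty C) : ObjectProperty C :=
  fun M => ∀ X : C, P X → ExtVanishes M X 1

/-- `(A, B)` is a cotorsion pair: `A^⊥ = B` and `A = ^⊥B`. -/
structure IsCotorsionPair (A B : ObjectProperty C) : Prop where
  rightPerp_eq : rightPerp A = B
  eq_leftPerp : A = leftPerp B

/-- `Ext^n(X, Y) = 0` for all `X` in `A`, all `Y` in `B` and all `n ≥ 1`. -/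
def IsHereditary (A B : ObjectProperty C) : Prop :=
  ∀ X Y : C, A X → B Y → ∀ n : ℕ, 1 ≤ n → ExtVanishes X Y n

/-- There is a (`w`-small) set `S` of objects with `(A, B) = (^⊥(S^⊥), S^⊥)`. -/
def IsGeneratedBySet (A B : ObjectProperty C) : Prop :=
  ∃ S : ObjectProperty C, ObjectProperty.Small.{w} S ∧
    A = leftPerp (rightPerp S) ∧ B = rightPerp S

end Cotorsion

/-! ### Left rooted quivers -/

section Rooted

variable (Q : Type w) [Quiver.{w} Q]

/-- The transfinite sequence `V_α` of sets of vertices: `V_0` is empty; `V_(β+1)` consists of the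
vertices `i` such that every arrow with target `i` has its source in the union of the `V_γ` with
`γ ≤ β`; and `V_α` is the union of the `V_β` with `β < α` if `α` is a limit ordinal.
See `rootedSeq_zero`, `rootedSeq_succ` and `rootedSeq_limit`. -/
def rootedSeq (α : Ordinal.{w}) : Set Q :=
  {i | (∃ β : Ordinal.{w}, ∃ _ : α = Order.succ β,
          ∀ (j : Q) (_ : j ⟶ i), ∃ γ : Ordinal.{w}, ∃ _ : γ ≤ β, j ∈ rootedSeq γ) ∨
        (Order.IsSuccLimit α ∧ ∃ β : Ordinal.{w}, ∃ _ : β < α, i ∈ rootedSeq β)}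
termination_by α
decreasing_by
  · subst_vars
    exact Order.lt_succ_of_le ‹_›
  · assumption

theorem rootedSeq_zero : rootedSeq Q 0 = ∅ := by
  ext i
  rw [rootedSeq]
  simp only [Set.mem_ofPred_eq, Set.mem_empty_iff_false, iff_false]
  rintro (⟨β, h, -⟩ | ⟨-, β, h, -⟩)
  · exact absurd h.symm (Order.succ_ne_bot β)
  · exact absurd h (not_lt_bot (a := β))

theorem rootedSeq_succ (β : Ordinal.{w}) :
    rootedSeq Q (Order.succ β) =
      {i | ¬ ∃ (j : Q) (_ : j ⟶ i), j ∉ ⋃ γ : Set.Iic β, rootedSeq Q γ} := by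
  ext i
  rw [rootedSeq]
  have key : (¬ ∃ (j : Q) (_ : j ⟶ i), j ∉ ⋃ γ : Set.Iic β, rootedSeq Q γ) ↔
      ∀ (j : Q) (_ : j ⟶ i), ∃ γ : Ordinal.{w}, ∃ _ : γ ≤ β, j ∈ rootedSeq Q γ := by
    simp
  rw [Set.mem_ofPred_eq, Set.mem_ofPred_eq, key]
  constructor
  · rintro (⟨β', h, H⟩ | ⟨h, -⟩)
    · rw [Order.succ_injective h]
      exact H
    · exact absurd h (Order.not_isSuccLimit_succ β)
  · exact fun H => Or.inl ⟨β, rfl, H⟩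

theorem rootedSeq_limit (α : Ordinal.{w}) (hα : Order.IsSuccLimit α) :
    rootedSeq Q α = ⋃ β : Set.Iio α, rootedSeq Q β := by
  ext i
  rw [rootedSeq]
  simp only [Set.mem_ofPred_eq, Set.mem_iUnion, Subtype.exists, Set.mem_Iio]
  constructor
  · rintro (⟨β, h, -⟩ | ⟨-, H⟩)
    · exact absurd (h ▸ hα) (Order.not_isSuccLimit_succ β)
    · exact H
  · exact fun H => Or.inr ⟨hα, H⟩

/-- `Q` is left rooted if `V_α` is the set of all vertices for some ordinal `α`. -/
def IsLeftRooted : Prop :=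
  ∃ α : Ordinal.{w}, rootedSeq Q α = Set.univ

end Rooted

/-! ### Representations of a quiver -/

section Representations

/-- The category `Rep(Q, M)` of `M`-valued representations of `Q`, as functors from the free
category on `Q` (the category of paths). By freeness such a functor is the same as an object
`X(i)` for every vertex `i` together with an arbitrary morphism `X(a) : X(i) ⟶ X(j)` for every
arrow `a : i ⟶ j`, and a natural transformation is the same as a family of morphisms
`X(i) ⟶ Y(i)` that commutes with the structure morphisms of all arrows. -/
abbrev QuiverRep (Q : Type w) [Quiver.{w} Q] (M : Type u) [Category.{v} M] :=
  Paths Q ⥤ M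

variable {Q : Type w} [Quiver.{w} Q] {M : Type u} [Category.{v} M]

/-- The object `X(i)` at the vertex `i`. -/
abbrev QuiverRep.at (X : QuiverRep Q M) (i : Q) : M :=
  X.obj ((Paths.of Q).obj i)

/-- The structure morphism `X(a) : X(i) ⟶ X(j)` of an arrow `a : i ⟶ j`. -/
abbrev QuiverRep.arrow (X : QuiverRep Q M) {i j : Q} (a : i ⟶ j) : X.at i ⟶ X.at j :=
  X.map ((Paths.of Q).map a)

/-- The canonical morphism `φ_i^X : ⨁_{a : j ⟶ i} X(j) ⟶ X(i)`; the coproduct is taken over the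
type `Quiver.Costar i` of all arrows `a` with target `i`. -/
noncomputable def phi [HasCoproducts.{w} M] (X : QuiverRep Q M) (i : Q) :
    (∐ fun a : Quiver.Costar i => X.at a.1) ⟶ X.at i :=
  Sigma.desc fun a : Quiver.Costar i => X.arrow a.2

/-- `Rep(Q, 𝒞)`: the representations with `X(i)` in `𝒞` for all vertices `i`. -/
def repClass (Q : Type w) [Quiver.{w} Q] (P : ObjectProperty M) :
    ObjectProperty (QuiverRep Q M) :=
  fun X => ∀ i : Q, P (X.at i)

/-- `Φ(𝒞)`: the representations such that `φ_i^X` is a monomorphism and both `X(i)` and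
`Coker φ_i^X` are in `𝒞`, for all vertices `i`. -/
def phiClass (Q : Type w) [Quiver.{w} Q] [Abelian M] [HasCoproducts.{w} M]
    (P : ObjectProperty M) : ObjectProperty (QuiverRep Q M) :=
  fun X => ∀ i : Q, Mono (phi X i) ∧ P (X.at i) ∧ P (cokernel (phi X i))

end Representations

end QuiverCotorsion

/-! Left rootedness enters only as well-foundedness of the relation "there is an arrow `j ⟶ i`". The
core is the equality Φ(A) = ⊥Rep(Q, B), proved in `phiClass_eq_leftPerp`.

For X in Φ(A) and Y in Rep(Q, B), embed Y in an injective E. A map X → E/Y is lifted to E by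
recursion over the vertices: compatibility with the lifts already chosen at the sources is a
diagonal problem for φ_i^X against E(i) → (E/Y)(i), solvable because Ext¹(X(i), Y(i)) and Ext¹(Coker
φ_i^X, Y(i)) vanish (`exists_lift_of_wellFounded`).

Conversely, X in ⊥Rep(Q, B) is tested against stalks at i with value in B. An extension by a stalk
that is split at every vertex forces φ_i^X to be mono, and lifting maps into stalks puts Coker φ_i^X
in A. Then X(i) is in A by induction, as an extension of the cokernel by a coproduct of earlier
values.

The other equality comes from the left adjoint F_i of evaluation at i: Ext¹(F_i V, Y) vanishes
exactly when Ext¹(V, Y(i)) does, so Rep(Q, S^⊥) is the right orthogonal of all F_i V with V in S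
(`rightPerp_iSup_free`). This also gives the generating set. Heredity is dimension shifting along
injective representations. -/

namespace QuiverCotorsion

/-! ### Vanishing of Ext as lifting and extension properties. -/

section ExtVanishing

variable {C : Type u} [Category.{v} C] [Abelian C]

lemma ExtVanishes.exists_lift {S : ShortComplex C} (hS : S.ShortExact) {X : C}
    (h : ExtVanishes X S.X₁ 1) (f : X ⟶ S.X₃) : ∃ g : X ⟶ S.X₂, g ≫ S.g = f := by
  let := HasExt.standard C
  have : Subsingleton (Abelian.Ext.{max u v} X S.X₁ 1) := h
  obtain ⟨x, hx⟩ := Abelian.Ext.covariant_sequence_exact₃ X hS (Abelian.Ext.mk₀ f) (zero_add 1)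
    (Subsingleton.elim _ _)
  obtain ⟨g, rfl⟩ := (Abelian.Ext.mk₀_bijective _ _).2 x
  rw [Abelian.Ext.mk₀_comp_mk₀] at hx
  exact ⟨g, (Abelian.Ext.mk₀_bijective _ _).1 hx⟩

lemma ExtVanishes.exists_extension {S : ShortComplex C} (hS : S.ShortExact) {Y : C}
    (h : ExtVanishes S.X₃ Y 1) (f : S.X₁ ⟶ Y) : ∃ g : S.X₂ ⟶ Y, S.f ≫ g = f := by
  let := HasExt.standard C
  have : Subsingleton (Abelian.Ext.{max u v} S.X₃ Y 1) := h
  obtain ⟨x, hx⟩ := Abelian.Ext.contravariant_sequence_exact₁ hS Y (Abelian.Ext.mk₀ f)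
    (add_zero 1) (Subsingleton.elim _ _)
  obtain ⟨g, rfl⟩ := (Abelian.Ext.mk₀_bijective _ _).2 x
  rw [Abelian.Ext.mk₀_comp_mk₀] at hx
  exact ⟨g, (Abelian.Ext.mk₀_bijective _ _).1 hx⟩

lemma ExtVanishes.of_injective (X I : C) [Injective I] (n : ℕ) : ExtVanishes X I (n + 1) :=
  let := HasExt.standard C
  Abelian.Ext.subsingleton_of_injective X I n

lemma ExtVanishes.of_projective (P Y : C) [Projective P] (n : ℕ) : ExtVanishes P Y (n + 1) :=
  let := HasExt.standard C
  subsingleton_of_forall_eq 0 Abelian.Ext.eq_zero_of_projective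

/-- Converse of `ExtVanishes.exists_lift`. With `S.X₂` injective it reduces every Ext¹ computation
below to a statement about morphisms. -/
lemma ExtVanishes.of_exists_lift {S : ShortComplex C} (hS : S.ShortExact) {X : C}
    (h₂ : ExtVanishes X S.X₂ 1) (h : ∀ f : X ⟶ S.X₃, ∃ g : X ⟶ S.X₂, g ≫ S.g = f) :
    ExtVanishes X S.X₁ 1 := by
  let := HasExt.standard C
  have : Subsingleton (Abelian.Ext.{max u v} X S.X₂ 1) := h₂
  refine subsingleton_of_forall_eq 0 fun x => ?_
  obtain ⟨y, rfl⟩ := Abelian.Ext.covariant_sequence_exact₁ X hS x (Subsingleton.elim _ _)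
    (zero_add 1)
  obtain ⟨f, rfl⟩ := (Abelian.Ext.mk₀_bijective _ _).2 y
  obtain ⟨g, rfl⟩ := h f
  rw [← Abelian.Ext.mk₀_comp_mk₀, Abelian.Ext.comp_assoc_of_second_deg_zero,
    hS.comp_extClass, Abelian.Ext.comp_zero]

lemma ExtVanishes.of_exists_extension {S : ShortComplex C} (hS : S.ShortExact) {Y : C}
    (h₂ : ExtVanishes S.X₂ Y 1) (h : ∀ f : S.X₁ ⟶ Y, ∃ g : S.X₂ ⟶ Y, S.f ≫ g = f) :
    ExtVanishes S.X₃ Y 1 := by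
  let := HasExt.standard C
  have : Subsingleton (Abelian.Ext.{max u v} S.X₂ Y 1) := h₂
  refine subsingleton_of_forall_eq 0 fun x => ?_
  obtain ⟨y, rfl⟩ := Abelian.Ext.contravariant_sequence_exact₃ hS Y x (Subsingleton.elim _ _)
    (add_zero 1)
  obtain ⟨f, rfl⟩ := (Abelian.Ext.mk₀_bijective _ _).2 y
  obtain ⟨g, rfl⟩ := h f
  rw [← Abelian.Ext.mk₀_comp_mk₀, ← Abelian.Ext.comp_assoc_of_second_deg_zero,
    hS.extClass_comp, Abelian.Ext.zero_comp]

/-- Dimension shifting in the second variable. -/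
lemma ExtVanishes.succ_of_shortExact {S : ShortComplex C} (hS : S.ShortExact) {X : C} {n : ℕ}
    (h₂ : ExtVanishes X S.X₂ (n + 1)) (h₃ : ExtVanishes X S.X₃ n) :
    ExtVanishes X S.X₁ (n + 1) := by
  let := HasExt.standard C
  have : Subsingleton (Abelian.Ext.{max u v} X S.X₂ (n + 1)) := h₂
  have : Subsingleton (Abelian.Ext.{max u v} X S.X₃ n) := h₃
  refine subsingleton_of_forall_eq 0 fun x => ?_
  obtain ⟨y, rfl⟩ := Abelian.Ext.covariant_sequence_exact₁ X hS x (Subsingleton.elim _ _) rfl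
  rw [Subsingleton.elim y 0, Abelian.Ext.zero_comp]

lemma ExtVanishes.of_shortExact_right {S : ShortComplex C} (hS : S.ShortExact) {X : C} {n : ℕ}
    (h₂ : ExtVanishes X S.X₂ n) (h₁ : ExtVanishes X S.X₁ (n + 1)) :
    ExtVanishes X S.X₃ n := by
  let := HasExt.standard C
  have : Subsingleton (Abelian.Ext.{max u v} X S.X₂ n) := h₂
  have : Subsingleton (Abelian.Ext.{max u v} X S.X₁ (n + 1)) := h₁
  refine subsingleton_of_forall_eq 0 fun x => ?_
  obtain ⟨y, rfl⟩ := Abelian.Ext.covariant_sequence_exact₃ X hS x rfl (Subsingleton.elim _ _)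
  rw [Subsingleton.elim y 0, Abelian.Ext.zero_comp]

lemma ExtVanishes.of_shortExact_middle {S : ShortComplex C} (hS : S.ShortExact) {Y : C} {n : ℕ}
    (h₁ : ExtVanishes S.X₁ Y n) (h₃ : ExtVanishes S.X₃ Y n) : ExtVanishes S.X₂ Y n := by
  let := HasExt.standard C
  have : Subsingleton (Abelian.Ext.{max u v} S.X₁ Y n) := h₁
  have : Subsingleton (Abelian.Ext.{max u v} S.X₃ Y n) := h₃
  refine subsingleton_of_forall_eq 0 fun x => ?_
  obtain ⟨y, rfl⟩ := Abelian.Ext.contravariant_sequence_exact₂ hS Y x (Subsingleton.elim _ _)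
  rw [Subsingleton.elim y 0, Abelian.Ext.comp_zero]

lemma shortExact_cokernel {X Y : C} (f : X ⟶ Y) [Mono f] :
    (ShortComplex.mk f (cokernel.π f) (cokernel.condition f)).ShortExact :=
  { exact := ShortComplex.exact_of_g_is_cokernel _ (cokernelIsCokernel f) }

lemma shortExact_kernel {X Y : C} (f : X ⟶ Y) [Epi f] :
    (ShortComplex.mk (kernel.ι f) f (kernel.condition f)).ShortExact :=
  { exact := ShortComplex.exact_of_f_is_kernel _ (kernelIsKernel f) }

/-- In a commutative square from a monomorphism `i` to an epimorphism `S.g`, a diagonal exists as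
soon as `Ext¹(X, Ker g)` and `Ext¹(Coker i, Ker g)` vanish. -/
lemma exists_diagonal {S : ShortComplex C} (hS : S.ShortExact) {W X : C} (i : W ⟶ X) [Mono i]
    (hX : ExtVanishes X S.X₁ 1) (hi : ExtVanishes (cokernel i) S.X₁ 1)
    (t : W ⟶ S.X₂) (b : X ⟶ S.X₃) (sq : t ≫ S.g = i ≫ b) :
    ∃ d : X ⟶ S.X₂, i ≫ d = t ∧ d ≫ S.g = b := by
  have := hS.mono_f
  -- An arbitrary lift `d` of `b` is corrected: its error `t - i ≫ d` on `W` factors through the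
  -- kernel of `S.g`, and that factor extends to all of `X`.
  obtain ⟨d, hd⟩ := hX.exists_lift hS b
  have h : (t - i ≫ d) ≫ S.g = 0 := by simp [sq, hd]
  obtain ⟨e, he⟩ := ExtVanishes.exists_extension (shortExact_cokernel i) hi (hS.exact.lift _ h)
  refine ⟨d + e ≫ S.f, ?_, by simp [hd]⟩
  dsimp at he
  rw [Preadditive.comp_add, reassoc_of% he, hS.exact.lift_f]
  abel

/-- Lifting along one fixed injective embedding of `Y` can be done summand by summand, so exactness
of coproducts plays no role. -/
lemma leftPerp_sigma [EnoughInjectives C] [HasCoproducts.{w} C] {P : ObjectProperty C} {J : Type w} (X : J → C)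
    (hX : ∀ j, leftPerp P (X j)) : leftPerp P (∐ X) := by
  intro Y hY
  refine ExtVanishes.of_exists_lift (shortExact_cokernel (Injective.ι Y))
    (ExtVanishes.of_injective _ _ 0) fun f => ?_
  choose g hg using fun j => (hX j Y hY).exists_lift (shortExact_cokernel (Injective.ι Y))
    (Sigma.ι X j ≫ f)
  exact ⟨Sigma.desc g, by ext j; simpa using hg j⟩

lemma leftPerp_middle {P : ObjectProperty C} {S : ShortComplex C} (hS : S.ShortExact)
    (h₁ : leftPerp P S.X₁) (h₃ : leftPerp P S.X₃) : leftPerp P S.X₂ :=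
  fun Y hY => (h₁ Y hY).of_shortExact_middle hS (h₃ Y hY)

lemma rightPerp_pi [EnoughProjectives C] [HasProducts.{w} C] {P : ObjectProperty C} {J : Type w}
    (Y : J → C) (hY : ∀ j, rightPerp P (Y j)) : rightPerp P (∏ᶜ Y) := by
  intro X hX
  refine ExtVanishes.of_exists_extension (shortExact_kernel (Projective.π X))
    (ExtVanishes.of_projective _ _ 0) fun f => ?_
  choose g hg using fun j => (hY j X hX).exists_extension (shortExact_kernel (Projective.π X))
    (f ≫ Pi.π Y j)
  exact ⟨Pi.lift g, by ext j; simpa using hg j⟩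

end ExtVanishing

/-! ### Exactness of coproducts and powers. -/

section Exactness

variable {C : Type u} [Category.{v} C] [Abelian C]

lemma sigmaMap_mono [HasCoproducts.{w} C] [AB4OfSize.{w} C] {J : Type w} {X Y : J → C}
    (f : ∀ j, X j ⟶ Y j) [∀ j, Mono (f j)] : Mono (Limits.Sigma.map f) := by
  have : Mono (Discrete.natTrans (F := Discrete.functor X) (G := Discrete.functor Y)
      fun j => f j.as) :=
    have : ∀ j, Mono ((Discrete.natTrans (F := Discrete.functor X) (G := Discrete.functor Y)
      fun j => f j.as).app j) := fun j => inferInstanceAs (Mono (f j.as))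
    NatTrans.mono_of_mono_app _
  exact inferInstanceAs (Mono (colim.map (Discrete.natTrans (F := Discrete.functor X)
    (G := Discrete.functor Y) fun j => f j.as)))

lemma piMap_epi [HasProducts.{w} C] [AB4StarOfSize.{w} C] {J : Type w} {X Y : J → C}
    (f : ∀ j, X j ⟶ Y j) [∀ j, Epi (f j)] : Epi (Limits.Pi.map f) := by
  have : Epi (Discrete.natTrans (F := Discrete.functor X) (G := Discrete.functor Y)
      fun j => f j.as) :=
    have : ∀ j, Epi ((Discrete.natTrans (F := Discrete.functor X) (G := Discrete.functor Y)
      fun j => f j.as).app j) := fun j => inferInstanceAs (Epi (f j.as))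
    NatTrans.epi_of_epi_app _
  exact inferInstanceAs (Epi (lim.map (Discrete.natTrans (F := Discrete.functor X)
    (G := Discrete.functor Y) fun j => f j.as)))

/-- Under AB4*, powers of a short exact sequence are short exact. -/
lemma shortExact_power [HasProducts.{w} C] [AB4StarOfSize.{w} C] {S : ShortComplex C}
    (hS : S.ShortExact) (J : Type w) :
    (ShortComplex.mk (Limits.Pi.map fun _ : J => S.f) (Limits.Pi.map fun _ : J => S.g)
      (by ext; simp)).ShortExact := by
  have := hS.mono_f
  have := hS.epi_g
  have := piMap_epi fun _ : J => S.g
  have : Mono (Limits.Pi.map fun _ : J => S.f) := inferInstance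
  refine { exact := ShortComplex.exact_of_f_is_kernel _ (KernelFork.IsLimit.ofι' _ _ ?_) }
  intro W k hk
  have h (j : J) : (k ≫ Pi.π _ j) ≫ S.g = 0 := by
    have := hk =≫ Pi.π _ j
    simpa using this
  exact ⟨Pi.lift fun j => hS.exact.lift _ (h j), by ext j; simp⟩

end Exactness

/-! ### Left rootedness as well-foundedness. -/

section WellFounded

lemma wellFounded_of_isLeftRooted (Q : Type w) [Quiver.{w} Q] (hQ : IsLeftRooted Q) :
    WellFounded fun j i : Q => Nonempty (j ⟶ i) := by
  have key (α : Ordinal.{w}) : ∀ i ∈ rootedSeq Q α, Acc (fun j i : Q => Nonempty (j ⟶ i)) i := by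
    induction α using WellFoundedLT.induction with
    | ind α ih =>
      intro i hi
      rw [rootedSeq] at hi
      rcases hi with ⟨β, rfl, h⟩ | ⟨-, β, hβ, h⟩
      · refine ⟨_, ?_⟩
        rintro j ⟨a⟩
        obtain ⟨γ, hγ, hj⟩ := h j a
        exact ih γ (Order.lt_succ_of_le hγ) j hj
      · exact ih β hβ i h
  obtain ⟨α, hα⟩ := hQ
  exact ⟨fun i => key α i (hα ▸ Set.mem_univ i)⟩

end WellFounded

/-! ### Representations described vertex by vertex. -/

section Representations

variable {Q : Type w} [Quiver.{w} Q] {M : Type u} [Category.{v} M]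

/-- The representation given by its objects at the vertices and its morphisms at the arrows. -/
abbrev QuiverRep.mk (obj : Q → M) (map : ∀ {i j : Q}, (i ⟶ j) → (obj i ⟶ obj j)) :
    QuiverRep Q M :=
  Paths.lift { obj := obj, map := map }

lemma QuiverRep.mk_arrow (obj : Q → M) (map : ∀ {i j : Q}, (i ⟶ j) → (obj i ⟶ obj j))
    {i j : Q} (a : i ⟶ j) : (QuiverRep.mk obj map).arrow a = map a :=
  Paths.lift_toPath _ _

/-- The morphism of representations given by its components at the vertices. -/
abbrev QuiverRep.homMk {X Y : QuiverRep Q M} (app : ∀ i : Q, X.at i ⟶ Y.at i)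
    (h : ∀ {i j : Q} (a : i ⟶ j), X.arrow a ≫ app j = app i ≫ Y.arrow a) : X ⟶ Y :=
  Paths.liftNatTrans app h

/-- The component of a morphism of representations at a vertex. -/
abbrev QuiverRep.homAt {X Y : QuiverRep Q M} (f : X ⟶ Y) (i : Q) : X.at i ⟶ Y.at i :=
  f.app ((Paths.of Q).obj i)

lemma QuiverRep.hom_ext {X Y : QuiverRep Q M} {f g : X ⟶ Y}
    (h : ∀ i : Q, QuiverRep.homAt f i = QuiverRep.homAt g i) : f = g :=
  NatTrans.ext (funext h)

lemma QuiverRep.comp_homAt {X Y Z : QuiverRep Q M} (f : X ⟶ Y) (g : Y ⟶ Z) (i : Q) :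
    QuiverRep.homAt (f ≫ g) i = QuiverRep.homAt f i ≫ QuiverRep.homAt g i :=
  rfl

lemma QuiverRep.arrow_homAt {X Y : QuiverRep Q M} (f : X ⟶ Y) {i j : Q} (a : i ⟶ j) :
    X.arrow a ≫ QuiverRep.homAt f j = QuiverRep.homAt f i ≫ Y.arrow a :=
  f.naturality _

variable (M) in
/-- The functor `X ↦ X(i)`. -/
abbrev evalAt (i : Q) : QuiverRep Q M ⥤ M := (evaluation (Paths Q) M).obj ((Paths.of Q).obj i)

lemma ι_phi [HasCoproducts.{w} M] (X : QuiverRep Q M) {i j : Q} (a : j ⟶ i) :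
    Sigma.ι (fun a : Quiver.Costar i => X.at a.1) ⟨j, a⟩ ≫ phi X i = X.arrow a := by
  simp [phi]

variable [Abelian M]

lemma shortExact_iff_at (S : ShortComplex (QuiverRep Q M)) :
    S.ShortExact ↔ ∀ i : Q, (S.map (evalAt M i)).ShortExact :=
  JointlyReflectIsomorphisms.shortExact_iff (F := fun i : Q => evalAt M i)
    ⟨fun f h => by
      have (i : Paths Q) : IsIso (f.app i) := h i
      exact (NatTrans.isIso_iff_isIso_app f).2 this⟩ S

/-- If the arrow relation is well-founded, then lifts along an epimorphism `S.g` of representations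
can be constructed vertex by vertex. -/
lemma exists_lift_of_wellFounded [HasCoproducts.{w} M]
    (hQ : WellFounded fun j i : Q => Nonempty (j ⟶ i))
    {S : ShortComplex (QuiverRep Q M)} (hS : S.ShortExact) {X : QuiverRep Q M}
    (hmono : ∀ i, Mono (phi X i)) (hX : ∀ i, ExtVanishes (X.at i) (S.X₁.at i) 1)
    (hcoker : ∀ i, ExtVanishes (cokernel (phi X i)) (S.X₁.at i) 1) (f : X ⟶ S.X₃) :
    ∃ g : X ⟶ S.X₂, g ≫ S.g = f := by
  let T (i : Q) : Type v :=
    { t : X.at i ⟶ S.X₂.at i // t ≫ QuiverRep.homAt S.g i = QuiverRep.homAt f i }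
  -- The recursion step: lifts prescribed at all sources of arrows into `i` assemble to a map out of
  -- the coproduct, and a compatible lift at `i` is a diagonal filling the square from `phi X i` to
  -- the epimorphism at `i`.
  have step (i : Q) (s : ∀ j, Nonempty (j ⟶ i) → T j) :
      ∃ t : T i, ∀ (j : Q) (a : j ⟶ i), X.arrow a ≫ t.1 = (s j ⟨a⟩).1 ≫ S.X₂.arrow a := by
    have := hmono i
    let t : (∐ fun a : Quiver.Costar i => X.at a.1) ⟶ S.X₂.at i :=
      Sigma.desc fun a : Quiver.Costar i => (s a.1 ⟨a.2⟩).1 ≫ S.X₂.arrow a.2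
    have sq : t ≫ QuiverRep.homAt S.g i = phi X i ≫ QuiverRep.homAt f i := by
      refine Sigma.hom_ext _ _ fun a => ?_
      rw [reassoc_of% (ι_phi X a.2), Sigma.ι_desc_assoc, Category.assoc, QuiverRep.arrow_homAt,
        QuiverRep.arrow_homAt, ← Category.assoc, (s a.1 ⟨a.2⟩).2]
    obtain ⟨d, hd, hd'⟩ : ∃ d : X.at i ⟶ S.X₂.at i, phi X i ≫ d = t ∧
        d ≫ QuiverRep.homAt S.g i = QuiverRep.homAt f i :=
      exists_diagonal ((shortExact_iff_at S).1 hS i) (phi X i) (hX i) (hcoker i) t _ sq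
    refine ⟨⟨d, hd'⟩, fun j a => ?_⟩
    rw [← ι_phi, Category.assoc, hd, Sigma.ι_desc]
  choose F hF using step
  let s (i : Q) : T i := hQ.fix F i
  refine ⟨QuiverRep.homMk (fun i => (s i).1) fun {j i} a => ?_, QuiverRep.hom_ext fun i => (s i).2⟩
  have h : s i = F i fun j _ => s j := hQ.fix_eq F i
  rw [h]
  exact hF i _ j a

/-! ### Extensions split at every vertex. -/

section Twisted

variable (X Y : QuiverRep Q M) (d : ∀ j k : Q, (j ⟶ k) → (X.at j ⟶ Y.at k))

/-- The extension of `X` by `Y` which is split at every vertex, with off-diagonal part `d` of the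
structure morphisms. -/
noncomputable def twistedSum : QuiverRep Q M :=
  QuiverRep.mk (fun i => Y.at i ⊞ X.at i) fun {j k} a =>
    biprod.lift (biprod.desc (Y.arrow a) (d j k a)) (biprod.snd ≫ X.arrow a)

lemma twistedSum_arrow {j k : Q} (a : j ⟶ k) : (twistedSum X Y d).arrow a =
    (biprod.lift (biprod.desc (Y.arrow a) (d j k a)) (biprod.snd ≫ X.arrow a) :
      Y.at j ⊞ X.at j ⟶ Y.at k ⊞ X.at k) :=
  QuiverRep.mk_arrow _ _ a

/-- The short complex `Y ⟶ twistedSum X Y d ⟶ X`. -/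
noncomputable abbrev twistedComplex : ShortComplex (QuiverRep Q M) where
  X₁ := Y
  X₂ := twistedSum X Y d
  X₃ := X
  f := QuiverRep.homMk (fun i => (biprod.inl : Y.at i ⟶ Y.at i ⊞ X.at i)) fun {j k} a => by
    have h : Y.arrow a ≫ biprod.inl = biprod.inl ≫ biprod.lift
        (biprod.desc (Y.arrow a) (d j k a)) (biprod.snd ≫ X.arrow a) := by
      apply biprod.hom_ext <;> simp
    rw [twistedSum_arrow]
    exact h
  g := QuiverRep.homMk (fun i => (biprod.snd : Y.at i ⊞ X.at i ⟶ X.at i)) fun a => by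
    rw [twistedSum_arrow]
    exact biprod.lift_snd _ _
  zero := QuiverRep.hom_ext fun i => biprod.inl_snd

lemma twistedComplex_shortExact : (twistedComplex X Y d).ShortExact := by
  refine (shortExact_iff_at _).2 fun i => ?_
  exact ShortComplex.Splitting.shortExact
    { r := (biprod.fst : Y.at i ⊞ X.at i ⟶ Y.at i)
      s := (biprod.inr : X.at i ⟶ Y.at i ⊞ X.at i)
      f_r := biprod.inl_fst
      s_g := biprod.inr_snd
      id := biprod.total }

variable {X Y} in
-- A section of the twisted extension has the identity as its `X`-component; its `Y`-components form
-- `c`, and compatibility with the arrows says that `c` cobounds `d`.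
lemma ExtVanishes.exists_cochain (h : ExtVanishes X Y 1) :
    ∃ c : ∀ i : Q, X.at i ⟶ Y.at i, ∀ {j k : Q} (a : j ⟶ k),
      X.arrow a ≫ c k = c j ≫ Y.arrow a + d j k a := by
  obtain ⟨s, hs⟩ := h.exists_lift (twistedComplex_shortExact X Y d) (𝟙 X)
  let t (i : Q) : X.at i ⟶ Y.at i ⊞ X.at i := QuiverRep.homAt s i
  have h₁ (i : Q) : t i ≫ biprod.snd = 𝟙 (X.at i) := congrArg (fun f => QuiverRep.homAt f i) hs
  have h₂ {j k : Q} (a : j ⟶ k) : X.arrow a ≫ t k =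
      t j ≫ biprod.lift (biprod.desc (Y.arrow a) (d j k a)) (biprod.snd ≫ X.arrow a) :=
    (QuiverRep.arrow_homAt s a).trans (congrArg (t j ≫ ·) (twistedSum_arrow X Y d a))
  refine ⟨fun i => t i ≫ biprod.fst, fun {j k} a => ?_⟩
  rw [← Category.assoc, h₂, Category.assoc, biprod.lift_fst, biprod.desc_eq, Preadditive.comp_add,
    reassoc_of% (h₁ j), Category.assoc]

end Twisted

/-! ### Stalk representations as test objects. -/

section Stalk

variable [HasProducts.{w} M]

/-- The stalk functor at `i`: `V` is placed at the vertex `i`, in the form of a power of `V` indexed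
by the subsingleton of proofs of `j = i` at every vertex `j`. -/
noncomputable def stalk (i : Q) : M ⥤ QuiverRep Q M where
  obj V := QuiverRep.mk (fun j => ∏ᶜ fun _ : ULift.{w} (PLift (j = i)) => V) fun _ => 0
  map f := QuiverRep.homMk (fun _ => Limits.Pi.map fun _ => f) fun a => by
    rw [QuiverRep.mk_arrow, QuiverRep.mk_arrow]
    exact zero_comp.trans comp_zero.symm
  map_id V := QuiverRep.hom_ext fun j => by
    exact Limits.Pi.map_id (f := fun _ : ULift.{w} (PLift (j = i)) => V)
  map_comp f g := QuiverRep.hom_ext fun j => by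
    exact (Limits.Pi.map_comp_map (fun _ : ULift.{w} (PLift (j = i)) => f) fun _ => g).symm

lemma stalk_arrow (i : Q) (V : M) {j k : Q} (a : j ⟶ k) : ((stalk i).obj V).arrow a = 0 :=
  QuiverRep.mk_arrow _ _ a

instance (i : Q) : (stalk (M := M) i).PreservesZeroMorphisms where
  map_zero X Y := QuiverRep.hom_ext fun j => Pi.hom_ext _ _ fun h =>
    by
    exact (Limits.Pi.map_π (fun _ : ULift.{w} (PLift (j = i)) => (0 : X ⟶ Y)) h).trans
      (comp_zero.trans zero_comp.symm)

lemma stalk_shortExact [AB4StarOfSize.{w} M] (i : Q) {S : ShortComplex M} (hS : S.ShortExact) :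
    (S.map (stalk (Q := Q) i)).ShortExact :=
  (shortExact_iff_at _).2 fun _ => shortExact_power hS _

/-- The projection of a stalk representation onto its value at the vertex `i`. -/
noncomputable def stalkπ (i : Q) (V : M) : ((stalk i).obj V).at i ⟶ V :=
  Pi.π (fun _ : ULift.{w} (PLift (i = i)) => V) ⟨⟨rfl⟩⟩

lemma stalk_map_π (i : Q) {V W : M} (f : V ⟶ W) :
    QuiverRep.homAt ((stalk i).map f) i ≫ stalkπ i W = stalkπ i V ≫ f :=
  Limits.Pi.map_π (fun _ : ULift.{w} (PLift (i = i)) => f) ⟨⟨rfl⟩⟩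

/-- The morphism to a stalk at the vertex `j` that is given by a morphism to `V` if `j = i`. -/
noncomputable def stalkLift (i : Q) {V W : M} {j : Q} (c : j = i → (W ⟶ V)) :
    W ⟶ ((stalk i).obj V).at j :=
  Pi.lift fun h : ULift.{w} (PLift (j = i)) => c h.down.down

lemma stalkLift_π (i : Q) {V W : M} (c : i = i → (W ⟶ V)) : stalkLift i c ≫ stalkπ i V = c rfl :=
  Pi.lift_π _ _

lemma comp_stalkLift (i : Q) {V W W' : M} {j : Q} (f : W' ⟶ W) (c : j = i → (W ⟶ V)) :
    f ≫ stalkLift i c = stalkLift i fun h => f ≫ c h :=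
  Pi.hom_ext _ _ fun h => by
    erw [Category.assoc, Pi.lift_π, Pi.lift_π]

lemma stalkLift_zero (i : Q) {V W : M} {j : Q} :
    stalkLift i (fun _ : j = i => (0 : W ⟶ V)) = 0 :=
  Pi.hom_ext _ _ fun _ => (Pi.lift_π _ _).trans zero_comp.symm

/-- A morphism `X(i) ⟶ V` annihilating all arrows into `i` is a morphism from `X` to the
stalk. -/
noncomputable def toStalk {X : QuiverRep Q M} {i : Q} {V : M} (c : X.at i ⟶ V)
    (hc : ∀ {j : Q} (a : j ⟶ i), X.arrow a ≫ c = 0) : X ⟶ (stalk i).obj V :=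
  QuiverRep.homMk (fun j => stalkLift i fun h : j = i => eqToHom (congrArg X.at h) ≫ c)
    fun {j k} a => by
      rw [stalk_arrow, comp_zero]
      refine (comp_stalkLift i _ _).trans ?_
      rw [← stalkLift_zero i]
      congr 1
      funext h
      subst h
      exact (congrArg _ (Category.id_comp _)).trans (hc a)

lemma toStalk_π {X : QuiverRep Q M} {i : Q} {V : M} (c : X.at i ⟶ V)
    (hc : ∀ {j : Q} (a : j ⟶ i), X.arrow a ≫ c = 0) :
    QuiverRep.homAt (toStalk c hc) i ≫ stalkπ i V = c :=
  (stalkLift_π i fun h : i = i => eqToHom (congrArg X.at h) ≫ c).trans (Category.id_comp _)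

variable [HasCoproducts.{w} M]

/-- Twist by the components of `e` on arrows into `i` and by zero elsewhere. As the stalk has zero
structure morphisms, the resulting cochain at `i` factors `e` through `phi X i`. -/
lemma mono_phi_of_extVanishes_stalk {X : QuiverRep Q M} {i : Q} {V : M}
    (hX : ExtVanishes X ((stalk i).obj V) 1)
    (e : (∐ fun a : Quiver.Costar i => X.at a.1) ⟶ V) [Mono e] : Mono (phi X i) := by
  obtain ⟨c, hc⟩ := hX.exists_cochain fun j k a => stalkLift i fun h : k = i =>
    Sigma.ι (fun a : Quiver.Costar i => X.at a.1) ⟨j, h ▸ a⟩ ≫ e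
  have h : phi X i ≫ c i ≫ stalkπ i V = e := by
    refine Sigma.hom_ext _ _ fun a => ?_
    rw [reassoc_of% (ι_phi X a.2), reassoc_of% (hc a.2), stalk_arrow, comp_zero, zero_add,
      stalkLift_π]
  exact mono_of_mono_fac h

/-- Morphisms `cokernel (phi X i) ⟶ W` correspond to morphisms from `X` to the stalk of `W` at `i`,
and stalks preserve short exact sequences. Hence a lifting problem for the cokernel against an
injective embedding of `V` becomes one for `X`. -/
lemma extVanishes_cokernel_phi [AB4StarOfSize.{w} M] [EnoughInjectives M] {X : QuiverRep Q M}
    {i : Q} {V : M} (hX : ExtVanishes X ((stalk i).obj V) 1) :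
    ExtVanishes (cokernel (phi X i)) V 1 := by
  refine ExtVanishes.of_exists_lift (shortExact_cokernel (Injective.ι V))
    (ExtVanishes.of_injective _ _ 0) fun (f : _ ⟶ cokernel (Injective.ι V)) => ?_
  have hf {j : Q} (a : j ⟶ i) : X.arrow a ≫ cokernel.π (phi X i) ≫ f = 0 := by
    rw [← ι_phi, Category.assoc, cokernel.condition_assoc, zero_comp, comp_zero]
  obtain ⟨g, hg⟩ : ∃ g : X ⟶ (stalk i).obj (Injective.under V),
      g ≫ (stalk i).map (cokernel.π (Injective.ι V)) = toStalk (cokernel.π (phi X i) ≫ f) hf :=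
    hX.exists_lift (stalk_shortExact i (shortExact_cokernel (Injective.ι V))) _
  refine ⟨cokernel.desc _ (QuiverRep.homAt g i ≫ stalkπ i (Injective.under V)) ?_, ?_⟩
  · refine Sigma.hom_ext _ _ fun a => ?_
    rw [reassoc_of% (ι_phi X a.2), reassoc_of% (QuiverRep.arrow_homAt g a.2), stalk_arrow,
      zero_comp, comp_zero, comp_zero]
  · rw [← cancel_epi (cokernel.π (phi X i)), cokernel.π_desc_assoc, Category.assoc, ← stalk_map_π,
      ← Category.assoc, ← QuiverRep.comp_homAt, hg, toStalk_π]

end Stalk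

end Representations

/-! ### The adjoints of evaluation at a vertex. -/

section Adjoints

variable {Q : Type w} [Quiver.{w} Q] {M : Type u} [Category.{v} M]

/-- The left adjoint of the evaluation at `i`. -/
noncomputable abbrev free [HasCoproducts.{w} M] (i : Q) : M ⥤ QuiverRep Q M :=
  evaluationLeftAdjoint M ((Paths.of Q).obj i)

/-- The left adjoint of the evaluation at `i` is left adjoint to it. -/
noncomputable abbrev freeAdj [HasCoproducts.{w} M] (i : Q) : free (M := M) i ⊣ evalAt M i :=
  evaluationAdjunctionRight M ((Paths.of Q).obj i)

instance [HasCoproducts.{w} M] (i : Q) : (free (M := M) i).IsLeftAdjoint :=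
  (freeAdj i).isLeftAdjoint

/-- The right adjoint of the evaluation at `i`. -/
noncomputable abbrev cofree [HasProducts.{w} M] (i : Q) : M ⥤ QuiverRep Q M :=
  evaluationRightAdjoint M ((Paths.of Q).obj i)

/-- The right adjoint of the evaluation at `i` is right adjoint to it. -/
noncomputable abbrev cofreeAdj [HasProducts.{w} M] (i : Q) : evalAt M i ⊣ cofree (M := M) i :=
  evaluationAdjunctionLeft M ((Paths.of Q).obj i)

variable [Abelian M]

/-- Right adjoints of the exact evaluations preserve injectives. The map to the product of the
coinduced injectives is mono at `i` because its component there, followed by the counit, is the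
chosen embedding of `Y.at i`. -/
lemma enoughInjectives_quiverRep [HasProducts.{w} M] [EnoughInjectives M] :
    EnoughInjectives (QuiverRep Q M) where
  presentation Y := by
    have (i : Q) : Injective ((cofree (M := M) i).obj (Injective.under (Y.at i))) :=
      Injective.injective_of_adjoint (cofreeAdj i) _
    let E : QuiverRep Q M := ∏ᶜ fun i : Q => (cofree (M := M) i).obj (Injective.under (Y.at i))
    let e (i : Q) : Y ⟶ (cofree (M := M) i).obj (Injective.under (Y.at i)) :=
      (cofreeAdj i).homEquiv _ _ (Injective.ι (Y.at i))
    let ι : Y ⟶ E := Pi.lift e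
    have he (i : Q) : QuiverRep.homAt (e i) i ≫ (cofreeAdj i).counit.app _ = Injective.ι (Y.at i) :=
      ((cofreeAdj i).homEquiv_counit ..).symm.trans (((cofreeAdj i).homEquiv _ _).symm_apply_apply _)
    have hι (i : Q) : Mono (QuiverRep.homAt ι i) := by
      have h : ι ≫ Pi.π (fun i => (cofree (M := M) i).obj (Injective.under (Y.at i))) i = e i :=
        Pi.lift_π _ _
      have hi := he i
      rw [← h, QuiverRep.comp_homAt, Category.assoc] at hi
      have : Mono (Injective.ι (Y.at i)) := Injective.ι_mono (Y.at i)
      exact mono_of_mono_fac hi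
    have (i : Paths Q) : Mono (ι.app i) := hι i
    exact ⟨{ J := E, f := ι, injective := inferInstance, mono := NatTrans.mono_of_mono_app ι }⟩

/-- Right exactness is automatic for a left adjoint. Monomorphisms are preserved by AB4, since the
value at `j` is a copower indexed by the paths from `i` to `j`. -/
lemma free_shortExact [HasCoproducts.{w} M] [AB4OfSize.{w} M] (i : Q) {S : ShortComplex M}
    (hS : S.ShortExact) : (S.map (free (Q := Q) i)).ShortExact := by
  have := hS.mono_f
  have := hS.epi_g
  have : PreservesColimitsOfSize.{0, 0} (free (Q := Q) (M := M) i) :=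
    (freeAdj i).leftAdjoint_preservesColimits
  have (j : Paths Q) : Mono (((free i).map S.f).app j) := by
    have h : ((free i).map S.f).app j =
        Limits.Sigma.map fun _ : ((Paths.of Q).obj i ⟶ j) => S.f :=
      Sigma.hom_ext _ _ fun _ => (Sigma.ι_desc _ _).trans 
        (Limits.Sigma.ι_map (fun _ : ((Paths.of Q).obj i ⟶ j) => S.f) _).symm
    exact h ▸ sigmaMap_mono _
  exact
    { exact := hS.exact.map_of_epi_of_preservesCokernel _ inferInstance inferInstance
      mono_f := NatTrans.mono_of_mono_app ((free i).map S.f)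
      epi_g := inferInstanceAs (Epi ((free i).map S.g)) }

/-- Both directions transport morphisms through the adjunction: a projective presentation of `A`
stays exact under `free i`, and an injective embedding of `Y` stays exact under evaluation. -/
lemma extVanishes_free_iff [HasCoproducts.{w} M] [AB4OfSize.{w} M] [HasProducts.{w} M]
    [EnoughProjectives M] [EnoughInjectives M] (i : Q) (A : M) (Y : QuiverRep Q M) :
    ExtVanishes ((free i).obj A) Y 1 ↔ ExtVanishes A (Y.at i) 1 := by
  have := enoughInjectives_quiverRep (Q := Q) (M := M)
  constructor
  · intro h
    refine ExtVanishes.of_exists_extension (shortExact_kernel (Projective.π A))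
      (ExtVanishes.of_projective _ _ 0) fun (f : kernel (Projective.π A) ⟶ Y.at i) => ?_
    obtain ⟨g, hg⟩ : ∃ g : (free i).obj (Projective.over A) ⟶ Y,
        (free i).map (kernel.ι (Projective.π A)) ≫ g = ((freeAdj i).homEquiv _ _).symm f :=
      h.exists_extension (free_shortExact i (shortExact_kernel (Projective.π A))) _
    refine ⟨(freeAdj i).homEquiv _ _ g, ?_⟩
    rw [← (freeAdj i).homEquiv_naturality_left, hg, Equiv.apply_symm_apply]
  · intro h
    refine ExtVanishes.of_exists_lift (shortExact_cokernel (Injective.ι Y))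
      (ExtVanishes.of_injective _ _ 0) fun (f : _ ⟶ cokernel (Injective.ι Y)) => ?_
    obtain ⟨g, hg⟩ : ∃ g : A ⟶ (evalAt M i).obj (Injective.under Y),
        g ≫ (evalAt M i).map (cokernel.π (Injective.ι Y)) = (freeAdj i).homEquiv _ _ f :=
      h.exists_lift ((shortExact_iff_at _).1 (shortExact_cokernel (Injective.ι Y)) i) _
    refine ⟨((freeAdj i).homEquiv _ _).symm g, ?_⟩
    rw [← (freeAdj i).homEquiv_naturality_right_symm, hg, Equiv.symm_apply_apply]

end Adjoints

/-! ### The induced cotorsion pair. -/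

section CotorsionPair

variable {M : Type u} [Category.{v} M] [Abelian M]
    [HasCoproducts.{w} M] [HasProducts.{w} M] [EnoughProjectives M] [EnoughInjectives M]
    (Q : Type w) [Quiver.{w} Q]

lemma rightPerp_iSup_free [AB4OfSize.{w} M] (S : ObjectProperty M) :
    rightPerp (⨆ i : Q, S.strictMap (free i)) = repClass Q (rightPerp S) := by
  ext Y
  constructor
  · intro hY i A hA
    refine (extVanishes_free_iff i A Y).1 (hY _ ?_)
    rw [ObjectProperty.prop_iSup_iff]
    exact ⟨i, S.strictMap_obj _ hA⟩
  · intro hY X hX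
    rw [ObjectProperty.prop_iSup_iff] at hX
    obtain ⟨i, A, hA⟩ := hX
    exact (extVanishes_free_iff i A Y).2 (hY i A hA)

/-- If `(A, B)` is hereditary, then `Rep(Q, B)` is closed under cokernels of monomorphisms, so that
the higher `Ext` groups vanish by dimension shifting along injective representations. -/
lemma isHereditary_leftPerp_repClass [AB4OfSize.{w} M] {A B : ObjectProperty M}
    (hAB : IsCotorsionPair A B) (h : IsHereditary A B) : IsHereditary (leftPerp (repClass Q B)) (repClass Q B) := by
  have := enoughInjectives_quiverRep (Q := Q) (M := M)
  intro X Y hX hY n hn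
  induction n, hn using Nat.le_induction generalizing Y with
  | base => exact hX Y hY
  | succ n hn ih =>
    have hS := shortExact_cokernel (Injective.ι Y)
    refine ExtVanishes.succ_of_shortExact hS (ExtVanishes.of_injective _ _ n) (ih _ fun i => ?_)
    rw [← hAB.rightPerp_eq]
    intro A' hA'
    refine ExtVanishes.of_shortExact_right ((shortExact_iff_at _).1 hS i) ?_
      (h _ _ hA' (hY i) 2 one_le_two)
    -- The value at `i` of an injective representation is right orthogonal to `A'`, because the
    -- representation itself is right orthogonal to `(free i).obj A'`.
    exact (extVanishes_free_iff i A' _).1 (ExtVanishes.of_injective _ _ 0)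

variable {Q} in
lemma phiClass_eq_leftPerp [AB4StarOfSize.{w} M]
    (hQ : WellFounded fun j i : Q => Nonempty (j ⟶ i)) {A B : ObjectProperty M}
    (hAB : IsCotorsionPair A B) : phiClass Q A = leftPerp (repClass Q B) := by
  have := enoughInjectives_quiverRep (Q := Q) (M := M)
  ext X
  constructor
  · intro hX Y hY
    have hA {V W : M} (hV : A V) (hW : B W) : ExtVanishes V W 1 := by
      rw [hAB.eq_leftPerp] at hV
      exact hV W hW
    exact ExtVanishes.of_exists_lift (shortExact_cokernel (Injective.ι Y))
      (ExtVanishes.of_injective _ _ 0) <|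
      exists_lift_of_wellFounded hQ (shortExact_cokernel (Injective.ι Y)) (fun i => (hX i).1)
        (fun i => hA (hX i).2.1 (hY i)) fun i => hA (hX i).2.2 (hY i)
  · intro hX
    have hstalk (i : Q) {V : M} (hV : B V) : ExtVanishes X ((stalk i).obj V) 1 := by
      -- At every vertex the stalk is a power of `V`, and `B`, being a right orthogonal, is closed
      -- under products.
      refine hX _ fun j => ?_
      rw [← hAB.rightPerp_eq] at hV ⊢
      exact rightPerp_pi _ fun _ => hV
    have hinj (V : M) [Injective V] : B V := by
      rw [← hAB.rightPerp_eq]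
      exact fun _ _ => ExtVanishes.of_injective _ _ 0
    have hmono (i : Q) : Mono (phi X i) :=
      mono_phi_of_extVanishes_stalk (hstalk i (hinj _)) (Injective.ι _)
    have hcoker (i : Q) : A (cokernel (phi X i)) := by
      rw [hAB.eq_leftPerp]
      exact fun V hV => extVanishes_cokernel_phi (hstalk i hV)
    refine fun i => ⟨hmono i, ?_, hcoker i⟩
    -- `X.at i` is an extension of `cokernel (phi X i)` by the coproduct of the values at the
    -- sources, which lie in `A` by induction.
    induction i using hQ.induction with
    | _ i ih =>
      have hsum : leftPerp B (∐ fun a : Quiver.Costar i => X.at a.1) :=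
        leftPerp_sigma _ fun a => hAB.eq_leftPerp ▸ ih a.1 ⟨a.2⟩
      have hc : leftPerp B (cokernel (phi X i)) := hAB.eq_leftPerp ▸ hcoker i
      rw [hAB.eq_leftPerp]
      exact leftPerp_middle (shortExact_cokernel (phi X i)) hsum hc

end CotorsionPair

end QuiverCotorsion

theorem theoremA {M : Type u} [Category.{v} M] [Abelian M]
    [HasCoproducts.{w} M] [AB4OfSize.{w} M] [HasProducts.{w} M] [AB4StarOfSize.{w} M]
    [EnoughProjectives M] [EnoughInjectives M]
    (Q : Type w) [Quiver.{w} Q] (hQ : QuiverCotorsion.IsLeftRooted Q)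
    (A B : ObjectProperty M) (hAB : QuiverCotorsion.IsCotorsionPair A B) :
    QuiverCotorsion.IsCotorsionPair
        (QuiverCotorsion.phiClass Q A) (QuiverCotorsion.repClass Q B) ∧
      (QuiverCotorsion.IsHereditary A B →
        QuiverCotorsion.IsHereditary
          (QuiverCotorsion.phiClass Q A) (QuiverCotorsion.repClass Q B)) ∧
      (QuiverCotorsion.IsGeneratedBySet.{w} A B →
        QuiverCotorsion.IsGeneratedBySet.{w}
          (QuiverCotorsion.phiClass Q A) (QuiverCotorsion.repClass Q B)) := by
  have hΦ := QuiverCotorsion.phiClass_eq_leftPerp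
    (QuiverCotorsion.wellFounded_of_isLeftRooted Q hQ) hAB
  refine ⟨⟨?_, hΦ⟩, fun h => ?_, ?_⟩
  · refine le_antisymm ?_ fun Y hY X hX => ?_
    · rw [← hAB.rightPerp_eq, ← QuiverCotorsion.rightPerp_iSup_free, hΦ]
      -- The free representations on objects of `A` are left orthogonal to `repClass Q B`, hence lie
      -- in `phiClass Q A`; orthogonality to them alone already forces the values into `B`.
      refine fun Y hY X hX => hY X fun Z hZ => ?_
      rw [← hAB.rightPerp_eq, ← QuiverCotorsion.rightPerp_iSup_free] at hZ
      exact hZ X hX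
    · rw [hΦ] at hX
      exact hX Y hY
  · rw [hΦ]
    exact QuiverCotorsion.isHereditary_leftPerp_repClass Q hAB h
  · rintro ⟨S, hS, -, rfl⟩
    have hB := QuiverCotorsion.rightPerp_iSup_free Q S
    -- The generating set consists of the free representations on `S` at all vertices; it is small
    -- because `S` and `Q` are.
    exact ⟨⨆ i : Q, S.strictMap (QuiverCotorsion.free i), inferInstance,
      by rw [hB, hΦ], hB.symm⟩
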